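/- Let $L(x)$ and $P(x)$ be complex-valued functions of a real variable such that, for every $t\in\mathbb{R}$, $L(x)=\log x+o((\log x)^t)$ and $P(x)=\frac{\operatorname{li}(x)}{x}+o((\log x)^t)$ as $x\to\infty$, where $\operatorname{li}(x)=\int_0^x\frac{dt}{\log t}$ (Cauchy principal value). For nonnegative integers $n$ let $D_n=n!\sum_{k=0}^n\frac{(-1)^k}{k!}$ be the number of derangements and $A_n=n!\sum_{k=0}^n\frac1{k!}$ the number of arrangements of an $n$-element set. Call a permutation of $\{1,\dots,n\}$ ($n\ge1$) indecomposable if it maps $\{1,\dots,j\}$ to itself for no $j$ with $1\le j<n$. For $n\ge1$ let $I_n$ be the number of indecomposable permutations, and $D_n'$ the number of indecomposable derangements, of $\{1,\dots,n\}$; let $D_0'=-1$. An asymptotic sequence is a sequence $\{\varphi_n(x)\}_{n\ge n_0}$ of functions with $\varphi_{n+1}(x)=o(\varphi_n(x))$ as $x\to\infty$ for all $n\ge n_0$. For such a sequence, $f(x)\sim\sum_{n\ge n_0}a_n\varphi_n(x)$ means that $f(x)-\sum_{k=n_0}^{n}a_k\varphi_k(x)=o(\varphi_n(x))$ as $x\to\infty$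 for every $n\ge n_0$. The $n$th approximant of a continued fraction $\cfrac{b_1(x)}{a_1(x)\,-}\ \cfrac{b_2(x)}{a_2(x)\,-}\ \cdots=\cfrac{b_1(x)}{a_1(x)-\cfrac{b_2(x)}{a_2(x)-\cdots}}$ is the finite continued fraction $w_n(x)$ that ends with $\frac{b_n(x)}{a_n(x)}$, and $w_0(x)=0$; the relation $f(x)\sim\cfrac{b_1(x)}{a_1(x)\,-}\ \cfrac{b_2(x)}{a_2(x)\,-}\ \cdots$ means that $\{w_n(x)-w_{n-1}(x)\}_{n\ge1}$ is an asymptotic sequence and $f(x)\sim\sum_{n=1}^\infty(w_n(x)-w_{n-1}(x))$ with respect to it. Then, as $x\to\infty$, the following asymptotic expansions hold; in 1–5 they are taken with respect to the asymptotic sequence of powers $\{L(x)^{-n}\}$, with $n$ starting at the lower limit of the sum. 1. $\displaystyle P(x)\sim\sum_{n=1}^\infty\frac{(n-1)!}{L(x)^n}$. 2. $\displaystyle P(ex)\sim\sum_{n=1}^\infty\frac{D_{n-1}}{L(x)^n}$. 3. $\displaystyle P(x/e)\sim\sum_{n=1}^\infty\frac{A_{n-1}}{L(x)^n}$. 4.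 $\displaystyle L(x)-\frac1{P(x)}\sim\sum_{n=0}^\infty\frac{I_{n+1}}{L(x)^n}$. 5. $\displaystyle \frac1{P(ex)}\sim-\sum_{n=-1}^\infty\frac{D_{n+1}'}{L(x)^n}$. 6. $\displaystyle P(x)\sim\cfrac{1}{L(x)-1\,-}\ \cfrac{1}{L(x)-3\,-}\ \cfrac{4}{L(x)-5\,-}\ \cfrac{9}{L(x)-7\,-}\ \cfrac{16}{L(x)-9\,-}\ \cdots$, where for $n\ge1$ the $(n+1)$st partial numerator is $n^2$ and the $n$th partial denominator is $L(x)-(2n-1)$. 7. $\displaystyle P(x)\sim\cfrac{1}{L(x)\,-}\ \cfrac{1}{1\,-}\ \cfrac{1}{L(x)\,-}\ \cfrac{2}{1\,-}\ \cfrac{2}{L(x)\,-}\ \cfrac{3}{1\,-}\ \cfrac{3}{L(x)\,-}\ \cdots$, where the partial denominators alternate between $L(x)$ and $1$, and after the first partial numerator $1$ every positive integer occurs twice in a row as a partial numerator. -/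

import Mathlib

open Filter Topology Asymptotics

/-- The logarithmic integral `li x`, the Cauchy principal value of `∫_0^x dt / log t`: the limit as
`ε → 0⁺` of the integral over `[0, x]` with the interval `(1 - ε, 1 + ε)` removed.  (At `t = 0`,
`1 / log t` is extended by `0`.) -/
noncomputable def logIntegral (x : ℝ) : ℝ :=
  limUnder (𝓝[>] (0 : ℝ))
    (fun ε : ℝ => ∫ t in Set.Icc 0 x \ Set.Ioo (1 - ε) (1 + ε), 1 / Real.log t)

/-- `φ 0, φ 1, φ 2, …` is an asymptotic sequence along the filter `l`. -/
def IsAsymptoticSequence {α : Type*} (l : Filter α) (φ : ℕ → α → ℂ) : Prop :=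
  ∀ n, φ (n + 1) =o[l] φ n

/-- `f ∼ a 0 * φ 0 + a 1 * φ 1 + ⋯` is an asymptotic expansion of infinite order along `l`, with
respect to the asymptotic sequence `φ`. -/
def HasAsymptoticExpansion {α : Type*} (l : Filter α) (f : α → ℂ) (a : ℕ → ℂ)
    (φ : ℕ → α → ℂ) : Prop :=
  IsAsymptoticSequence l φ ∧
    ∀ n, (fun x => f x - ∑ k ∈ Finset.range (n + 1), a k * φ k x) =o[l] φ n

/-- The `n`th approximant of the continued fraction `b 0 / (a 0 + b 1 / (a 1 + b 2 / (a 2 + ⋯)))`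
without leading term, that is `b 0 / (a 0 + b 1 / (a 1 + ⋯ + b (n-1) / a (n-1)))`; the approximant
number `0` is `0`. -/
noncomputable def contFractApprox (b a : ℕ → ℂ) (n : ℕ) : ℂ :=
  GenContFract.convs' ⟨0, Stream'.Seq.ofStream fun k => ⟨b k, a k⟩⟩ n

/-- `f ∼ b 0 / (a 0 + b 1 / (a 1 + b 2 / (a 2 + ⋯)))` is an asymptotic continued fraction expansion
along `l`: the differences `w 1 - w 0, w 2 - w 1, …` of consecutive approximants form an asymptotic
sequence, and `f ∼ (w 1 - w 0) + (w 2 - w 1) + ⋯` is an asymptotic expansion with respect to it.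
The term `w 0` vanishes identically, as there is no leading term, and so is not listed. -/
def HasAsymptoticContFract {α : Type*} (l : Filter α) (f : α → ℂ) (b a : ℕ → α → ℂ) : Prop :=
  HasAsymptoticExpansion l f (fun _ => 1)
    (fun n x => contFractApprox (fun k => b k x) (fun k => a k x) (n + 1) -
      contFractApprox (fun k => b k x) (fun k => a k x) n)

/-- The number `n! * ∑_{k ≤ n} 1 / k!` of arrangements of an `n`-element set. -/
def numArrangements (n : ℕ) : ℚ :=
  (n.factorial : ℚ) * ∑ k ∈ Finset.range (n + 1), 1 / (k.factorial : ℚ)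

/-- A permutation of `n ≥ 1` letters is indecomposable if it maps no initial segment of length `j`,
`1 ≤ j < n`, to itself.  (Here the letters are `0, …, n - 1`, and the initial segment of length `j`
consists of the letters `i < j`.) -/
def IsIndecomposablePerm {n : ℕ} (σ : Equiv.Perm (Fin n)) : Prop :=
  0 < n ∧ ∀ j : Fin n, 0 < (j : ℕ) → ¬ ∀ i : Fin n, i < j → σ i < j

/-- The number of indecomposable permutations of `n` letters (`0` for `n = 0`). -/
noncomputable def numIndecomposablePerms (n : ℕ) : ℕ :=
  Nat.card {σ : Equiv.Perm (Fin n) // IsIndecomposablePerm σ}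

/-- The number of indecomposable derangements of `n` letters for `n ≥ 1`, and `-1` for `n = 0`. -/
noncomputable def numIndecomposableDerangements (n : ℕ) : ℤ :=
  if n = 0 then -1
  else Nat.card {σ : Equiv.Perm (Fin n) // IsIndecomposablePerm σ ∧ σ ∈ derangements (Fin n)}

/-! With `u = log x`, the function `F(u) = li(e^(u+c)) / e^(u+c)` satisfies `F' + F = 1/(u+c)`.
Expanding the right side in powers of `1/u` forces the coefficients `a (n+1) = (n+1) a n +
(-c)^(n+1)`, `a 0 = 1`: factorials for `c = 0`, derangement numbers for `c = 1`, arrangement numbers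
for `c = -1`. The remainder solves the same kind of equation with a small right side, and
`isBigO_of_hasDerivAt` shows that it is equally small. Errors beyond all orders do not affect such
expansions (`HasPowerExpansion.perturb`), so `log` and `li x / x` may be replaced by `L` and `P`.

Reciprocals reduce to formal power series: splitting off the first indecomposable block of a
permutation (`card_eq_sum_indecomposable`) gives `A = 1 + C A` for the generating functions, hence
`1/A = 1 - C`.

For the continued fractions, `f - w n` times the denominator of `w n` obeys the three-term
recurrence of the fraction (`sub_contFractApprox_mul`). Its coefficients are found in closed form;
they contain a falling factorial that kills the initial ones, so each approximant is of strictly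
higher accuracy than the preceding one. -/

/-- `f ∼ a 0 + a 1 * z + a 2 * z ^ 2 + ⋯` along `l`, with error terms `O(z ^ N)`. -/
def HasPowerExpansion {α : Type*} (l : Filter α) (z f : α → ℂ) (a : ℕ → ℂ) : Prop :=
  ∀ N : ℕ, (fun x => f x - ∑ k ∈ Finset.range N, a k * z x ^ k) =O[l] fun x => z x ^ N

/-! ### Calculus of expansions in powers of a function tending to zero -/

namespace HasPowerExpansion

variable {α : Type*} {l : Filter α} {z w f g : α → ℂ} {a b : ℕ → ℂ}

theorem congr' (hf : HasPowerExpansion l z f a) (h : f =ᶠ[l] g) : HasPowerExpansion l z g a :=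
  fun N => (hf N).congr' (h.mono fun x hx => by simp only [hx]) EventuallyEq.rfl

theorem sub (hf : HasPowerExpansion l z f a) (hg : HasPowerExpansion l z g b) :
    HasPowerExpansion l z (fun x => f x - g x) (fun n => a n - b n) := fun N =>
  ((hf N).sub (hg N)).congr_left fun x => by
    simp only [sub_mul, Finset.sum_sub_distrib]; ring

theorem const_mul (c : ℂ) (hf : HasPowerExpansion l z f a) :
    HasPowerExpansion l z (fun x => c * f x) (fun n => c * a n) := fun N =>
  ((hf N).const_mul_left c).congr_left fun x => by
    simp only [mul_sub, Finset.mul_sum, mul_assoc]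

/-- Removal of the constant term, followed by division by `z`. -/
theorem sub_div (hf : HasPowerExpansion l z f a) (hz : ∀ᶠ x in l, z x ≠ 0) :
    HasPowerExpansion l z (fun x => (f x - a 0) / z x) (fun n => a (n + 1)) := fun N => by
  have h := (hf (N + 1)).mul (isBigO_refl (fun x => (z x)⁻¹) l)
  refine h.congr' ?_ ?_
  · filter_upwards [hz] with x hx
    rw [Finset.sum_range_succ']
    have : ∑ k ∈ Finset.range N, a (k + 1) * z x ^ (k + 1) =
        z x * ∑ k ∈ Finset.range N, a (k + 1) * z x ^ k := by
      rw [Finset.mul_sum]; exact Finset.sum_congr rfl fun k _ => by ring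
    rw [this]; field_simp; ring
  · filter_upwards [hz] with x hx
    rw [pow_succ, mul_inv_cancel_right₀ hx]

/-- An expansion whose first `n` coefficients vanish has size `z ^ n`, if the next one does not. -/
theorem isTheta (hf : HasPowerExpansion l z f a) (hz : Tendsto z l (𝓝 0)) {n : ℕ}
    (h0 : ∀ k < n, a k = 0) (hn : a n ≠ 0) : f =Θ[l] fun x => z x ^ n := by
  have h1 : (fun x => f x - a n * z x ^ n) =o[l] fun x => z x ^ n := by
    have := hf (n + 1)
    simp only [Finset.sum_range_succ] at this
    have hs : ∀ x, ∑ k ∈ Finset.range n, a k * z x ^ k = 0 := fun x =>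
      Finset.sum_eq_zero fun k hk => by rw [h0 k (Finset.mem_range.1 hk), zero_mul]
    simp only [hs, zero_add] at this
    refine this.trans_isLittleO ?_
    have h2 : z =o[l] fun _ => (1 : ℂ) := (isLittleO_one_iff ℂ).2 hz
    simpa [pow_succ] using (isBigO_refl (fun x => z x ^ n) l).mul_isLittleO h2
  have h2 : (fun x => a n * z x ^ n) =Θ[l] fun x => z x ^ n :=
    (isTheta_refl _ _).const_mul_left hn
  have h3 : (fun x => f x - a n * z x ^ n) =o[l] fun x => a n * z x ^ n := h1.trans_isTheta h2.symm
  have h4 : f ~[l] fun x => a n * z x ^ n := h3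
  exact h4.isTheta.trans h2

theorem tendsto (hf : HasPowerExpansion l z f a) (hz : Tendsto z l (𝓝 0)) :
    Tendsto f l (𝓝 (a 0)) := by
  have h := (hf 1).trans_tendsto (by simpa using hz)
  simpa using h.add_const (a 0)

/-- The reciprocal of an expansion with reciprocal coefficient series. -/
theorem inv (hf : HasPowerExpansion l z f a) (hz : Tendsto z l (𝓝 0))
    (hab : PowerSeries.mk a * PowerSeries.mk b = 1) :
    HasPowerExpansion l z (fun x => (f x)⁻¹) b := by
  have ha : a 0 ≠ 0 := by
    have := congrArg (PowerSeries.coeff 0) hab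
    rw [PowerSeries.coeff_mul] at this
    simp at this
    exact left_ne_zero_of_mul_eq_one this
  have hlim := hf.tendsto hz
  have hinv : (fun x => (f x)⁻¹) =O[l] fun _ => (1 : ℂ) := (hlim.inv₀ ha).isBigO_one ℂ
  intro N
  set p := PowerSeries.trunc N (PowerSeries.mk a) with hp
  set q := PowerSeries.trunc N (PowerSeries.mk b) with hq
  have hpe : ∀ x, p.eval (z x) = ∑ k ∈ Finset.range N, a k * z x ^ k := fun x => by
    simpa using PowerSeries.eval₂_trunc_eq_sum_range (RingHom.id ℂ) (s := z x) N (PowerSeries.mk a)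
  have hqe : ∀ x, q.eval (z x) = ∑ k ∈ Finset.range N, b k * z x ^ k := fun x => by
    simpa using PowerSeries.eval₂_trunc_eq_sum_range (RingHom.id ℂ) (s := z x) N (PowerSeries.mk b)
  -- With `p q = 1 + X^N s`, the error is `1/f - q = -((f - p) q + z^N s) / f`, and both summands
  -- are `O(z^N)`.
  have hdvd : (Polynomial.X : Polynomial ℂ) ^ N ∣ p * q - 1 := by
    rw [Polynomial.X_pow_dvd_iff]
    intro d hd
    have := congrArg (PowerSeries.coeff d) hab
    rw [PowerSeries.coeff_mul] at this
    rw [Polynomial.coeff_sub, Polynomial.coeff_mul, sub_eq_zero]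
    rw [Polynomial.coeff_one]
    rw [PowerSeries.coeff_one] at this
    rw [← this]
    refine Finset.sum_congr rfl fun ij hij => ?_
    have := Finset.HasAntidiagonal.mem_antidiagonal.1 hij
    rw [hp, hq, PowerSeries.coeff_trunc, PowerSeries.coeff_trunc, if_pos (by omega),
      if_pos (by omega)]
  obtain ⟨s, hs⟩ := hdvd
  have hbdd : ∀ r : Polynomial ℂ, (fun x => r.eval (z x)) =O[l] fun _ => (1 : ℂ) := fun r =>
    ((r.continuous.tendsto 0).comp hz).isBigO_one ℂ
  have h1 : (fun x => (f x - p.eval (z x)) * q.eval (z x)) =O[l] fun x => z x ^ N := by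
    have := (hf N).mul (hbdd q)
    simpa only [← hpe, mul_one] using this
  have h2 : (fun x => z x ^ N * s.eval (z x)) =O[l] fun x => z x ^ N := by
    have := (isBigO_refl (fun x => z x ^ N) l).mul (hbdd s)
    simpa only [mul_one] using this
  have h3 := ((h1.add h2).neg_left).mul hinv
  simp only [mul_one] at h3
  refine h3.congr' ?_ EventuallyEq.rfl
  filter_upwards [hlim.eventually_ne ha] with x hx
  have := congrArg (Polynomial.eval (z x)) hs
  simp only [Polynomial.eval_sub, Polynomial.eval_mul, Polynomial.eval_one, Polynomial.eval_pow,
    Polynomial.eval_X] at this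
  rw [← hqe, ← this]
  field_simp
  ring

/-- A perturbation of the function and of the variable beyond all orders. -/
theorem perturb (hf : HasPowerExpansion l w f a) (hw : Tendsto w l (𝓝 0))
    (hfg : ∀ N : ℕ, (fun x => g x - f x) =O[l] fun x => w x ^ N)
    (hwz : ∀ N : ℕ, (fun x => z x - w x) =O[l] fun x => w x ^ N) :
    HasPowerExpansion l z g a := by
  have hw1 : w =o[l] fun _ => (1 : ℂ) := (isLittleO_one_iff ℂ).2 hw
  -- Exponent 2 suffices: `z - w = O(w²) = o(w)`.
  have hequiv : z ~[l] w := by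
    refine (hwz 2).trans_isLittleO ?_
    simpa [pow_two] using (isBigO_refl w l).mul_isLittleO hw1
  have hz : Tendsto z l (𝓝 0) := (hequiv.isBigO).trans_tendsto hw
  intro N
  have h1 : ∀ k, (fun x => w x ^ k - z x ^ k) =O[l] fun x => w x ^ N := fun k => by
    have hs : (fun x => ∑ i ∈ Finset.range k, w x ^ i * z x ^ (k - 1 - i)) =O[l]
        fun _ => (1 : ℂ) := by
      have : Tendsto (fun x => ∑ i ∈ Finset.range k, w x ^ i * z x ^ (k - 1 - i)) l
          (𝓝 (∑ i ∈ Finset.range k, (0 : ℂ) ^ i * 0 ^ (k - 1 - i))) :=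
        tendsto_finsetSum _ fun i _ => (hw.pow i).mul (hz.pow _)
      exact this.isBigO_one ℂ
    have := hs.mul ((hwz N).neg_left)
    simp only [one_mul] at this
    refine this.congr_left fun x => ?_
    rw [← (Commute.all (w x) (z x)).geom_sum₂_mul k]
    ring
  have h2 : (fun x => ∑ k ∈ Finset.range N, a k * (w x ^ k - z x ^ k)) =O[l]
      fun x => w x ^ N := by
    simpa only [Finset.sum_fn] using
      IsBigO.sum (s := Finset.range N) fun k _ => (h1 k).const_mul_left (a k)
  have h3 := ((hf N).add h2).add (hfg N)
  refine (h3.congr_left fun x => ?_).trans (hequiv.symm.isBigO.pow N)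
  simp only [mul_sub, Finset.sum_sub_distrib]
  ring

/-- Passage to an asymptotic expansion with respect to the sequence `z ^ n`. -/
theorem hasAsymptoticExpansion (hf : HasPowerExpansion l z f a) (hz : Tendsto z l (𝓝 0)) :
    HasAsymptoticExpansion l f a (fun n x => z x ^ n) := by
  have hz1 : z =o[l] fun _ => (1 : ℂ) := (isLittleO_one_iff ℂ).2 hz
  have h : ∀ n : ℕ, (fun x => z x ^ (n + 1)) =o[l] fun x => z x ^ n := fun n => by
    simpa [pow_succ] using (isBigO_refl (fun x => z x ^ n) l).mul_isLittleO hz1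
  exact ⟨h, fun n => (hf (n + 1)).trans_isLittleO (h n)⟩

end HasPowerExpansion

/-- Multiplication of an asymptotic expansion by a fixed function. -/
theorem HasAsymptoticExpansion.of_mul {α : Type*} {l : Filter α} {f g h : α → ℂ} {a : ℕ → ℂ}
    {φ ψ : ℕ → α → ℂ} (hf : HasAsymptoticExpansion l f a φ)
    (hg : g =ᶠ[l] fun x => h x * f x) (hψ : ∀ᶠ x in l, ∀ n, ψ n x = h x * φ n x) :
    HasAsymptoticExpansion l g a ψ := by
  have hψ' : ∀ n, (fun x => h x * φ n x) =ᶠ[l] ψ n := fun n =>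
    hψ.mono fun x hx => (hx n).symm
  refine ⟨fun n => ?_, fun n => ?_⟩
  · exact ((isBigO_refl h l).mul_isLittleO (hf.1 n)).congr' (hψ' _) (hψ' _)
  · refine ((isBigO_refl h l).mul_isLittleO (hf.2 n)).congr' ?_ (hψ' _)
    filter_upwards [hg, hψ] with x hx hx'
    rw [hx, mul_sub, Finset.mul_sum]
    congr 1
    exact Finset.sum_congr rfl fun k _ => by rw [hx']; ring

/-! ### Continued fractions and their three-term recurrences -/

theorem contFractApprox_zero (b a : ℕ → ℂ) : contFractApprox b a 0 = 0 := by
  simp [contFractApprox, GenContFract.convs', GenContFract.convs'Aux]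

theorem contFractApprox_succ (b a : ℕ → ℂ) (n : ℕ) :
    contFractApprox b a (n + 1) =
      b 0 / (a 0 + contFractApprox (fun k => b (k + 1)) (fun k => a (k + 1)) n) := by
  simp only [contFractApprox, GenContFract.convs', zero_add]
  rfl

/-- Solutions of the three-term recurrence `u (n + 2) = a n * u (n + 1) + b n * u n`, which the
numerators and denominators of the approximants of a continued fraction satisfy. -/
def contFractRec (b a : ℕ → ℂ) (u₀ u₁ : ℂ) : ℕ → ℂ
  | 0 => u₀
  | 1 => u₁
  | n + 2 => a n * contFractRec b a u₀ u₁ (n + 1) + b n * contFractRec b a u₀ u₁ n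

theorem contFractRec_add_two (b a : ℕ → ℂ) (u₀ u₁ : ℂ) (n : ℕ) :
    contFractRec b a u₀ u₁ (n + 2) =
      a n * contFractRec b a u₀ u₁ (n + 1) + b n * contFractRec b a u₀ u₁ n := rfl

/-- The error `y - w n` of an approximant, times its denominator. -/
theorem sub_contFractApprox_mul (b a : ℕ → ℂ) (y : ℂ) (n : ℕ)
    (h : ∀ k m, k + m + 1 = n →
      a k + contFractApprox (fun i => b (i + (k + 1))) (fun i => a (i + (k + 1))) m ≠ 0) :
    (y - contFractApprox b a n) * contFractRec b a 0 1 (n + 1) =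
      contFractRec b a (-1) y (n + 1) := by
  -- The fraction is unrolled `k` levels, with the remaining tail of length `m` kept as one
  -- quantity. At `k = 0` the identity is trivial; at `k = n` the tail is `0` and the claim remains.
  have key : ∀ k m, k + m = n →
      (y - contFractApprox b a n) * (contFractRec b a 0 1 (k + 1) +
        contFractApprox (fun i => b (i + k)) (fun i => a (i + k)) m * contFractRec b a 0 1 k) =
      contFractRec b a (-1) y (k + 1) +
        contFractApprox (fun i => b (i + k)) (fun i => a (i + k)) m *
          contFractRec b a (-1) y k := by
    intro k
    induction k with
    | zero =>
      intro m hm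
      rw [zero_add] at hm
      subst hm
      simp only [contFractRec, add_zero]
      ring
    | succ k ih =>
      intro m hm
      have h0 := h k m (by omega)
      have h1 := ih (m + 1) (by omega)
      rw [contFractApprox_succ] at h1
      simp only [zero_add, add_assoc, add_comm 1 k] at h1
      rw [contFractRec_add_two, contFractRec_add_two]
      set T := contFractApprox (fun i => b (i + (k + 1))) (fun i => a (i + (k + 1))) m
      field_simp at h1
      linear_combination h1
  have := key n 0 rfl
  simpa only [contFractApprox_zero, zero_mul, add_zero] using this

section

variable {α : Type*} {l : Filter α}

/-- If each approximant is asymptotically closer to `f` than the preceding one, then they form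
an asymptotic continued fraction expansion. -/
theorem hasAsymptoticContFract_of_isLittleO {f : α → ℂ} {b a : ℕ → α → ℂ}
    (h : ∀ n, (fun x => f x - contFractApprox (fun k => b k x) (fun k => a k x) (n + 1)) =o[l]
      fun x => f x - contFractApprox (fun k => b k x) (fun k => a k x) n) :
    HasAsymptoticContFract l f b a := by
  set w : ℕ → α → ℂ := fun n x => contFractApprox (fun k => b k x) (fun k => a k x) n with hw
  -- Each increment is equivalent to the error it corrects, so errors may replace increments in both
  -- requirements; the partial sums telescope.
  have hequiv : ∀ n, (fun x => w (n + 1) x - w n x) ~[l] fun x => f x - w n x := fun n =>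
    (h n).neg_left.congr_left fun x => by simp only [hw, Pi.sub_apply]; ring
  refine ⟨fun n => ?_, fun n => ?_⟩
  · exact ((hequiv (n + 1)).isBigO.trans_isLittleO (h n)).trans_isTheta (hequiv n).isTheta.symm
  · refine ((h n).trans_isTheta (hequiv n).isTheta.symm).congr_left fun x => ?_
    have := Finset.sum_range_sub (fun n => w n x) (n + 1)
    simp only [one_mul]
    rw [this]
    simp only [hw, contFractApprox_zero, sub_zero]

/-- The error `f - w n` is a recurrence solution of order `z^(d n)` divided by a denominator of
order `z^(-m n)`, so it has exact order `z^(d n + m n)`. Nonvanishing of the inner denominators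
makes this quotient formula valid. -/
theorem hasAsymptoticContFract_of_isTheta {f z : α → ℂ} {b a : ℕ → α → ℂ} {d m : ℕ → ℕ}
    (hz : Tendsto z l (𝓝 0))
    (ha : ∀ k n, ∀ᶠ x in l, a k x +
      contFractApprox (fun i => b (i + (k + 1)) x) (fun i => a (i + (k + 1)) x) n ≠ 0)
    (hr : ∀ n, (fun x => contFractRec (fun k => b k x) (fun k => a k x) (-1) (f x) (n + 1)) =Θ[l]
      fun x => z x ^ d n)
    (hq : ∀ n, Tendsto (fun x => contFractRec (fun k => b k x) (fun k => a k x) 0 1 (n + 1) *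
      z x ^ m n) l (𝓝 1))
    (hdm : ∀ n, d n + m n < d (n + 1) + m (n + 1)) :
    HasAsymptoticContFract l f b a := by
  have key : ∀ n, (fun x => f x - contFractApprox (fun k => b k x) (fun k => a k x) n) =Θ[l]
      fun x => z x ^ (d n + m n) := fun n => by
    have hden : ∀ᶠ x in l, ∀ k m, k + m + 1 = n → a k x +
        contFractApprox (fun i => b (i + (k + 1)) x) (fun i => a (i + (k + 1)) x) m ≠ 0 := by
      have : ∀ᶠ x in l, ∀ k ∈ Finset.range n, a k x + contFractApprox
          (fun i => b (i + (k + 1)) x) (fun i => a (i + (k + 1)) x) (n - 1 - k) ≠ 0 :=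
        (Finset.eventually_all _).2 fun k _ => ha k _
      filter_upwards [this] with x hx k m hkm
      have := hx k (Finset.mem_range.2 (by omega))
      rwa [show n - 1 - k = m by omega] at this
    have h1 : (fun x => (contFractRec (fun k => b k x) (fun k => a k x) 0 1 (n + 1) *
        z x ^ m n)) =Θ[l] fun _ => (1 : ℂ) := (isEquivalent_const_iff_tendsto one_ne_zero).2
          (hq n) |>.isTheta
    have h2 := ((hr n).mul (isTheta_refl (fun x => z x ^ m n) l)).div h1
    simp only [div_one, ← pow_add] at h2
    refine EventuallyEq.trans_isTheta ?_ h2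
    filter_upwards [hden, (hq n).eventually_ne one_ne_zero] with x hx hxq
    have := sub_contFractApprox_mul (fun k => b k x) (fun k => a k x) (f x) n hx
    rw [← this, mul_assoc, mul_div_cancel_right₀ _ hxq]
  refine hasAsymptoticContFract_of_isLittleO fun n =>
    ((key (n + 1)).isBigO.trans_isLittleO ?_).trans_isTheta (key n).symm
  have hz1 : z =o[l] fun _ => (1 : ℂ) := (isLittleO_one_iff ℂ).2 hz
  have h3 : (fun x => z x ^ (d (n + 1) + m (n + 1) - (d n + m n))) =o[l] fun _ => (1 : ℂ) := by
    have := hz.pow (d (n + 1) + m (n + 1) - (d n + m n))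
    rw [zero_pow (Nat.sub_ne_zero_of_lt (hdm n))] at this
    exact (isLittleO_one_iff ℂ).2 this
  have h4 := (isBigO_refl (fun x => z x ^ (d n + m n)) l).mul_isLittleO h3
  refine h4.congr (fun x => ?_) fun x => mul_one _
  rw [← pow_add, Nat.add_sub_of_le (hdm n).le]

/-! ### The J-fraction and S-fraction of the factorial series -/

variable {L f : α → ℂ}

theorem eventually_add_ne_zero_of_inv_tendsto_zero {g : α → ℂ} {c : ℂ}
    (hz : Tendsto (fun x => (L x)⁻¹) l (𝓝 0)) (hz0 : ∀ᶠ x in l, (L x)⁻¹ ≠ 0)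
    (hg : Tendsto g l (𝓝 c)) :
    (∀ᶠ x in l, L x + g x ≠ 0) ∧ Tendsto (fun x => (L x + g x)⁻¹) l (𝓝 0) := by
  have h1 : Tendsto (fun x => 1 + (L x)⁻¹ * g x) l (𝓝 1) := by
    simpa using (hz.mul hg).const_add 1
  have h2 : ∀ᶠ x in l, L x + g x = L x * (1 + (L x)⁻¹ * g x) := by
    filter_upwards [hz0] with x hx
    have : L x ≠ 0 := by simpa using hx
    field_simp
  constructor
  · filter_upwards [h2, hz0, h1.eventually_ne one_ne_zero] with x hx hx0 hx1
    rw [hx]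
    exact mul_ne_zero (by simpa using hx0) hx1
  · have := hz.mul (h1.inv₀ one_ne_zero)
    rw [zero_mul] at this
    refine this.congr' ?_
    filter_upwards [h2] with x hx
    rw [hx, mul_inv]

theorem cast_descFactorial_succ (k n : ℕ) :
    (k.descFactorial (n + 1) : ℂ) = (k - n) * k.descFactorial n := by
  rw [Nat.descFactorial_succ]
  rcases le_or_gt n k with h | h
  · push_cast [h]; ring
  · rw [Nat.descFactorial_of_lt h]; simp

theorem isTheta_of_mul_hasPowerExpansion {r : α → ℂ} {c : ℕ → ℂ} {n : ℕ}
    (hz : Tendsto (fun x => (L x)⁻¹) l (𝓝 0)) (hz0 : ∀ᶠ x in l, (L x)⁻¹ ≠ 0)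
    (hr : HasPowerExpansion l (fun x => (L x)⁻¹) (fun x => r x * L x) c)
    (h0 : ∀ k < n, c k = 0) (hn : c n ≠ 0) :
    r =Θ[l] fun x => (L x)⁻¹ ^ (n + 1) := by
  have h := (hr.isTheta hz h0 hn).mul (isTheta_refl (fun x => (L x)⁻¹) l)
  simp only [← pow_succ] at h
  refine EventuallyEq.trans_isTheta ?_ h
  filter_upwards [hz0] with x hx
  exact (mul_inv_cancel_right₀ (by simpa using hx) _).symm

/-- The asymptotic continued fraction (J-fraction) of `∑ n! / L ^ (n + 1)`. -/
theorem hasAsymptoticContFract_factorial_jFraction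
    (hz : Tendsto (fun x => (L x)⁻¹) l (𝓝 0)) (hz0 : ∀ᶠ x in l, (L x)⁻¹ ≠ 0)
    (hf : HasPowerExpansion l (fun x => (L x)⁻¹) (fun x => f x * L x) fun n => n.factorial) :
    HasAsymptoticContFract l f
      (fun k _ => if k = 0 then 1 else -(k : ℂ) ^ 2)
      (fun k x => L x - (2 * (k : ℂ) + 1)) := by
  refine hasAsymptoticContFract_of_isTheta (d := fun n => n + 1) (m := fun n => n) hz ?_ ?_ ?_
    fun n => by omega
  -- Every tail is a constant over `L` plus a convergent term, hence tends to `0`.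
  · have htail : ∀ n k, Tendsto (fun x => contFractApprox
        (fun i => if i + (k + 1) = 0 then 1 else -((i + (k + 1) : ℕ) : ℂ) ^ 2)
        (fun i => L x - (2 * ((i + (k + 1) : ℕ) : ℂ) + 1)) n) l (𝓝 0) := by
      intro n
      induction n with
      | zero => intro k; simp only [contFractApprox_zero]; exact tendsto_const_nhds
      | succ n ih =>
        intro k
        have h1 := (ih (k + 1)).add_const (-(2 * ((k + 1 : ℕ) : ℂ) + 1))
        have h2 := ((eventually_add_ne_zero_of_inv_tendsto_zero hz hz0 h1).2).const_mul
          (-((k + 1 : ℕ) : ℂ) ^ 2)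
        rw [mul_zero] at h2
        refine h2.congr fun x => ?_
        rw [contFractApprox_succ, div_eq_mul_inv]
        simp only [zero_add, add_assoc, add_comm 1 (k + 1), if_neg (Nat.succ_ne_zero k)]
        congr 2
        ring
    intro k n
    have h1 := (htail n k).add_const (-(2 * (k : ℂ) + 1))
    filter_upwards [(eventually_add_ne_zero_of_inv_tendsto_zero hz hz0 h1).1] with x hx
    convert hx using 1
    ring
  · intro n
    -- Multiplication by `L` shifts the coefficients, the constant term being zero after the first
    -- step. Over the common factor `k! (k)_n`, the recurrence is then `(k+1)² - (2n+3)(k-n) -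
    -- (n+1)² = (k-n)(k-n-1)`.
    have key : ∀ n, HasPowerExpansion l (fun x => (L x)⁻¹) (fun x => contFractRec
        (fun k => if k = 0 then 1 else -(k : ℂ) ^ 2) (fun k => L x - (2 * (k : ℂ) + 1))
        (-1) (f x) (n + 1) * L x) (fun k => k.factorial * k.descFactorial n) := by
      intro n
      induction n using Nat.twoStepInduction with
      | zero => simpa [contFractRec] using hf
      | one =>
        have h := (hf.sub_div hz0).sub hf
        convert h using 1
        · ext x
          simp [contFractRec]
          ring
        · ext k
          rw [cast_descFactorial_succ, Nat.factorial_succ]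
          push_cast
          simp
          ring
      | more n ih0 ih1 =>
        have h := ((ih1.sub_div hz0).sub (ih1.const_mul (2 * (n + 1 : ℕ) + 1))).sub
          (ih0.const_mul (((n + 1 : ℕ) : ℂ) ^ 2))
        convert h using 1
        · ext x
          rw [contFractRec_add_two _ _ _ _ (n + 1)]
          simp only [Nat.succ_ne_zero, if_false, div_inv_eq_mul, Nat.zero_descFactorial_succ]
          push_cast
          ring
        · ext k
          rw [cast_descFactorial_succ, cast_descFactorial_succ, Nat.succ_descFactorial_succ,
            Nat.factorial_succ]
          push_cast
          ring
    refine isTheta_of_mul_hasPowerExpansion hz hz0 (key n) (fun k hk => ?_) ?_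
    · rw [Nat.descFactorial_of_lt hk]; simp
    · rw [Nat.descFactorial_self]
      exact_mod_cast (Nat.mul_pos n.factorial_pos n.factorial_pos).ne'
  · intro n
    induction n using Nat.twoStepInduction with
    | zero => simpa [contFractRec] using tendsto_const_nhds
    | one =>
      have h : Tendsto (fun x => 1 - (L x)⁻¹) l (𝓝 1) := by simpa using hz.const_sub 1
      refine h.congr' ?_
      filter_upwards [hz0] with x hx
      have : L x ≠ 0 := by simpa using hx
      simp [contFractRec]
      field_simp
    | more n ih0 ih1 =>
      have h := ((hz.const_mul (2 * (n + 1 : ℂ) + 1)).const_sub 1).mul ih1 |>.sub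
        (((hz.pow 2).const_mul ((n + 1 : ℂ) ^ 2)).mul ih0)
      simp only [mul_zero, sub_zero, one_mul, ne_eq, OfNat.ofNat_ne_zero, not_false_eq_true,
        zero_pow, zero_mul] at h
      refine h.congr' ?_
      filter_upwards [hz0] with x hx
      have hLx : L x ≠ 0 := by simpa using hx
      rw [contFractRec_add_two _ _ _ _ (n + 1)]
      simp only [Nat.succ_ne_zero, if_false]
      have hL1 : L x * (L x)⁻¹ = 1 := mul_inv_cancel₀ hLx
      push_cast
      linear_combination (-(contFractRec (fun k => if k = 0 then 1 else -(k : ℂ) ^ 2)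
        (fun k => L x - (2 * (k : ℂ) + 1)) 0 1 (n + 1 + 1)) * (L x)⁻¹ ^ (n + 1)) * hL1

/-- The asymptotic continued fraction (S-fraction) of `∑ n! / L ^ (n + 1)`. -/
theorem hasAsymptoticContFract_factorial_sFraction
    (hz : Tendsto (fun x => (L x)⁻¹) l (𝓝 0)) (hz0 : ∀ᶠ x in l, (L x)⁻¹ ≠ 0)
    (hf : HasPowerExpansion l (fun x => (L x)⁻¹) (fun x => f x * L x) fun n => n.factorial) :
    HasAsymptoticContFract l f
      (fun k _ => if k = 0 then 1 else -(((k + 1) / 2 : ℕ) : ℂ))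
      (fun k x => if Even k then L x else 1) := by
  set b : ℕ → ℂ := fun k => if k = 0 then 1 else -(((k + 1) / 2 : ℕ) : ℂ) with hb
  set a : ℕ → α → ℂ := fun k x => if Even k then L x else 1 with ha
  have b0 : b 0 = 1 := rfl
  have b1 : ∀ n, b (2 * n + 1) = -(n + 1) := fun n => by
    rw [hb]
    simp only [Nat.succ_ne_zero, if_false]
    rw [show (2 * n + 1 + 1) / 2 = n + 1 by omega]
    push_cast; rfl
  have b2 : ∀ n, b (2 * n + 2) = -(n + 1) := fun n => by
    rw [hb]
    simp only [Nat.succ_ne_zero, if_false]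
    rw [show (2 * n + 2 + 1) / 2 = n + 1 by omega]
    push_cast; rfl
  have a0 : ∀ n x, a (2 * n) x = L x := fun n x => by simp [ha]
  have a1 : ∀ n x, a (2 * n + 1) x = 1 := fun n x => by simp [ha]
  have a2 : ∀ n x, a (2 * n + 2) x = L x := fun n x => a0 (n + 1) x
  -- The degree of the denominator in `L` and the order of the remainder increase alternately, so
  -- each approximant gains one order; in the J-fraction each gains two.
  refine hasAsymptoticContFract_of_isTheta (d := fun n => n / 2 + 1) (m := fun n => (n + 1) / 2)
    hz ?_ ?_ ?_ fun n => by omega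
  -- Tails starting at an even index are divided by `L` and vanish in the limit; those starting at
  -- an odd index are divided by `1` and merely converge.
  · have htail : ∀ n k,
        Tendsto (fun x => contFractApprox (fun i => b (i + 2 * k)) (fun i => a (i + 2 * k) x) n)
          l (𝓝 0) ∧
        ∃ c, Tendsto (fun x => contFractApprox (fun i => b (i + (2 * k + 1)))
          (fun i => a (i + (2 * k + 1)) x) n) l (𝓝 c) := by
      intro n
      induction n with
      | zero => simp only [contFractApprox_zero]; exact fun k => ⟨tendsto_const_nhds, 0,
          tendsto_const_nhds⟩
      | succ n ih =>
        intro k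
        simp only [contFractApprox_succ, zero_add, add_assoc]
        constructor
        · obtain ⟨c, hc⟩ := (ih k).2
          have := ((eventually_add_ne_zero_of_inv_tendsto_zero hz hz0 hc).2).const_mul (b (2 * k))
          rw [mul_zero] at this
          simpa only [a0, add_comm 1, div_eq_mul_inv] using this
        · have := ((((ih (k + 1)).1.const_add 1).inv₀ (by simp)).const_mul (b (2 * k + 1)))
          refine ⟨b (2 * k + 1) * (1 + 0)⁻¹, ?_⟩
          simpa only [a1, show 1 + (2 * k + 1) = 2 * (k + 1) by omega, div_eq_mul_inv] using this
    intro k n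
    obtain ⟨k, rfl | rfl⟩ := k.even_or_odd'
    · obtain ⟨c, hc⟩ := (htail n k).2
      simpa only [a0] using (eventually_add_ne_zero_of_inv_tendsto_zero hz hz0 hc).1
    · simp only [a1, add_assoc, show 1 + 1 = 2 from rfl]
      exact ((htail n (k + 1)).1.const_add 1).eventually_ne (by simp)
  -- The even approximants are those of the J-fraction, whence the same coefficients; the odd ones
  -- interpolate with `(k+1)!` in place of `k!`.
  · have key : ∀ n,
        HasPowerExpansion l (fun x => (L x)⁻¹)
          (fun x => contFractRec b (fun k => a k x) (-1) (f x) (2 * n + 1) * L x)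
          (fun k => k.factorial * k.descFactorial n) ∧
        HasPowerExpansion l (fun x => (L x)⁻¹)
          (fun x => contFractRec b (fun k => a k x) (-1) (f x) (2 * n + 2) * L x)
          (fun k => (k + 1).factorial * k.descFactorial n) := by
      intro n
      induction n with
      | zero =>
        refine ⟨by simpa [contFractRec] using hf, ?_⟩
        convert hf.sub_div hz0 using 1
        · ext x
          simp only [contFractRec, b0, a0 0 x, div_inv_eq_mul, Nat.factorial_zero, Nat.cast_one]
          ring
        · ext k; simp
      | succ n ih =>
        have h1 : HasPowerExpansion l (fun x => (L x)⁻¹)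
            (fun x => contFractRec b (fun k => a k x) (-1) (f x) (2 * n + 3) * L x)
            (fun k => k.factorial * k.descFactorial (n + 1)) := by
          convert ih.2.sub (ih.1.const_mul (n + 1)) using 1
          · ext x
            rw [contFractRec_add_two _ _ _ _ (2 * n + 1), a1, b1]
            ring
          · ext k
            rw [cast_descFactorial_succ, Nat.factorial_succ]
            push_cast
            ring
        refine ⟨h1, ?_⟩
        convert (h1.sub_div hz0).sub (ih.2.const_mul (n + 1)) using 1
        · ext x
          change contFractRec b (fun k => a k x) (-1) (f x) (2 * n + 2 + 2) * L x = _
          rw [contFractRec_add_two _ _ _ _ (2 * n + 2), a2, b2]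
          simp only [div_inv_eq_mul, Nat.zero_descFactorial_succ]
          push_cast
          ring
        · ext k
          rw [cast_descFactorial_succ, Nat.succ_descFactorial_succ]
          push_cast
          ring
    intro n
    obtain ⟨n, rfl | rfl⟩ := n.even_or_odd'
    · simp only [show 2 * n / 2 = n by omega]
      refine isTheta_of_mul_hasPowerExpansion hz hz0 (key n).1 (fun k hk => ?_) ?_
      · rw [Nat.descFactorial_of_lt hk]; simp
      · rw [Nat.descFactorial_self]
        exact_mod_cast (Nat.mul_pos n.factorial_pos n.factorial_pos).ne'
    · simp only [show (2 * n + 1) / 2 = n by omega]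
      refine isTheta_of_mul_hasPowerExpansion hz hz0 (key n).2 (fun k hk => ?_) ?_
      · rw [Nat.descFactorial_of_lt hk]; simp
      · rw [Nat.descFactorial_self]
        exact_mod_cast (Nat.mul_pos (n + 1).factorial_pos n.factorial_pos).ne'
  · have key : ∀ n,
        Tendsto (fun x => contFractRec b (fun k => a k x) 0 1 (2 * n + 1) * (L x)⁻¹ ^ n) l (𝓝 1) ∧
        Tendsto (fun x => contFractRec b (fun k => a k x) 0 1 (2 * n + 2) * (L x)⁻¹ ^ (n + 1)) l
          (𝓝 1) := by
      intro n
      induction n with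
      | zero =>
        refine ⟨by simpa [contFractRec] using tendsto_const_nhds, ?_⟩
        refine (tendsto_const_nhds (x := (1 : ℂ))).congr' ?_
        filter_upwards [hz0] with x hx
        simp [contFractRec, ha, show L x ≠ 0 by simpa using hx]
      | succ n ih =>
        have h1 : Tendsto (fun x => contFractRec b (fun k => a k x) 0 1 (2 * n + 3) *
            (L x)⁻¹ ^ (n + 1)) l (𝓝 1) := by
          have h := ih.2.sub ((hz.const_mul ((n : ℂ) + 1)).mul ih.1)
          simp only [mul_zero, zero_mul, sub_zero] at h
          refine h.congr fun x => ?_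
          rw [contFractRec_add_two _ _ _ _ (2 * n + 1), a1, b1]
          ring
        refine ⟨h1, ?_⟩
        have h := h1.sub ((hz.const_mul ((n : ℂ) + 1)).mul ih.2)
        simp only [mul_zero, zero_mul, sub_zero] at h
        refine h.congr' ?_
        filter_upwards [hz0] with x hx
        have hLx : L x ≠ 0 := by simpa using hx
        change _ = contFractRec b (fun k => a k x) 0 1 (2 * n + 2 + 2) * _
        rw [contFractRec_add_two _ _ _ _ (2 * n + 2), a2, b2]
        have hL1 : L x * (L x)⁻¹ = 1 := mul_inv_cancel₀ hLx
        linear_combination (-(contFractRec b (fun k => a k x) 0 1 (2 * n + 3)) *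
          (L x)⁻¹ ^ (n + 1)) * hL1
    intro n
    obtain ⟨n, rfl | rfl⟩ := n.even_or_odd'
    · simpa only [show (2 * n + 1) / 2 = n by omega] using (key n).1
    · simpa only [show (2 * n + 1 + 1) / 2 = n + 1 by omega] using (key n).2

end

/-! ### Direct sums and the first indecomposable block -/

/-- The direct sum of two permutations: `α` on the first `k` letters, `β` on the remaining ones. -/
def permDirectSum {k m : ℕ} (α : Equiv.Perm (Fin k)) (β : Equiv.Perm (Fin m)) :
    Equiv.Perm (Fin (k + m)) :=
  finSumFinEquiv.permCongr (Equiv.Perm.sumCongrHom (Fin k) (Fin m) (α, β))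

section

variable {k m : ℕ} (α : Equiv.Perm (Fin k)) (β : Equiv.Perm (Fin m))

@[simp]
theorem permDirectSum_castAdd (i : Fin k) :
    permDirectSum α β (Fin.castAdd m i) = Fin.castAdd m (α i) := by
  simp [permDirectSum, Equiv.permCongr_apply]

@[simp]
theorem permDirectSum_natAdd (i : Fin m) :
    permDirectSum α β (Fin.natAdd k i) = Fin.natAdd k (β i) := by
  simp [permDirectSum, Equiv.permCongr_apply]

theorem permDirectSum_injective : Function.Injective fun p : Equiv.Perm (Fin k) ×
    Equiv.Perm (Fin m) => permDirectSum p.1 p.2 := fun _ _ h =>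
  Equiv.Perm.sumCongrHom_injective (finSumFinEquiv.permCongr.injective h)

theorem permDirectSum_mem_derangements_iff :
    permDirectSum α β ∈ derangements (Fin (k + m)) ↔
      α ∈ derangements (Fin k) ∧ β ∈ derangements (Fin m) := by
  constructor
  · intro h
    refine ⟨fun i hi => h (Fin.castAdd m i) ?_, fun i hi => h (Fin.natAdd k i) ?_⟩
    · rw [permDirectSum_castAdd, hi]
    · rw [permDirectSum_natAdd, hi]
  · rintro ⟨h1, h2⟩ i
    induction i using Fin.addCases with
    | left i => rw [permDirectSum_castAdd]; exact fun h => h1 i (Fin.castAdd_injective _ _ h)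
    | right i => rw [permDirectSum_natAdd]; exact fun h => h2 i (Fin.natAdd_injective _ _ h)

end

/-- `σ` maps the initial segment of length `j` to itself. -/
def PreservesInitial {n : ℕ} (σ : Equiv.Perm (Fin n)) (j : ℕ) : Prop :=
  ∀ i : Fin n, (i : ℕ) < j → (σ i : ℕ) < j

/-- By finiteness, a permutation mapping the left summand into itself also preserves the right one,
so it splits. -/
theorem exists_permDirectSum_eq {k m : ℕ} {σ : Equiv.Perm (Fin (k + m))}
    (h : PreservesInitial σ k) : ∃ α β, permDirectSum (k := k) (m := m) α β = σ := by
  set τ := (finSumFinEquiv (m := k) (n := m)).symm.permCongr σ with hτ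
  have hmaps : Set.MapsTo τ (Set.range Sum.inl) (Set.range Sum.inl) := by
    rintro _ ⟨i, rfl⟩
    have hlt : (σ (Fin.castAdd m i) : ℕ) < k := h _ (by simp)
    refine ⟨⟨_, hlt⟩, ?_⟩
    rw [hτ, Equiv.permCongr_apply]
    simp only [Equiv.symm_symm, finSumFinEquiv_apply_left]
    rw [← finSumFinEquiv_symm_apply_castAdd]
    rfl
  obtain ⟨⟨α, β⟩, hαβ⟩ := Equiv.Perm.mem_sumCongrHom_range_of_perm_mapsTo_inl hmaps
  refine ⟨α, β, ?_⟩
  rw [permDirectSum, hαβ, hτ]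
  ext i
  simp [Equiv.permCongr_apply]

theorem preservesInitial_permDirectSum_iff {k m j : ℕ} (α : Equiv.Perm (Fin k))
    (β : Equiv.Perm (Fin m)) (hj : j ≤ k) :
    PreservesInitial (permDirectSum α β) j ↔ PreservesInitial α j := by
  constructor
  · intro h i hi
    simpa using h (Fin.castAdd m i) (by simpa using hi)
  · intro h i hi
    induction i using Fin.addCases with
    | left i => simpa using h i (by simpa using hi)
    | right i => simp at hi; omega

theorem preservesInitial_self {n : ℕ} (σ : Equiv.Perm (Fin n)) : PreservesInitial σ n :=
  fun i _ => (σ i).isLt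

theorem isIndecomposablePerm_iff {n : ℕ} (σ : Equiv.Perm (Fin n)) :
    IsIndecomposablePerm σ ↔ 0 < n ∧ ∀ j, 0 < j → j < n → ¬ PreservesInitial σ j :=
  and_congr_right fun _ => ⟨fun h j h0 hj => h ⟨j, hj⟩ h0, fun h j h0 => h j h0 j.isLt⟩

/-- The length of the first indecomposable block of a permutation of `n ≥ 1` letters is `j`. -/
def HasFirstBlock {n : ℕ} (σ : Equiv.Perm (Fin n)) (j : ℕ) : Prop :=
  0 < j ∧ PreservesInitial σ j ∧ ∀ i, 0 < i → i < j → ¬ PreservesInitial σ i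

theorem existsUnique_hasFirstBlock {n : ℕ} (hn : 0 < n) (σ : Equiv.Perm (Fin n)) :
    ∃! j, HasFirstBlock σ j := by
  classical
  have hex : ∃ j, 0 < j ∧ PreservesInitial σ j := ⟨n, hn, preservesInitial_self σ⟩
  refine ⟨Nat.find hex, ⟨(Nat.find_spec hex).1, (Nat.find_spec hex).2,
    fun i h0 hi h => Nat.find_min hex hi ⟨h0, h⟩⟩, ?_⟩
  rintro j ⟨h0, hj, hmin⟩
  refine ((Nat.find_eq_iff hex).2 ⟨⟨h0, hj⟩, fun i hi h => hmin i h.1 hi h.2⟩).symm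

theorem HasFirstBlock.le {n j : ℕ} {σ : Equiv.Perm (Fin n)} (hn : 0 < n)
    (h : HasFirstBlock σ j) : j ≤ n := by
  by_contra hlt
  exact h.2.2 n hn (by omega) (preservesInitial_self σ)

theorem hasFirstBlock_permDirectSum_iff {k m : ℕ} (α : Equiv.Perm (Fin k))
    (β : Equiv.Perm (Fin m)) :
    HasFirstBlock (permDirectSum α β) k ↔ IsIndecomposablePerm α := by
  rw [isIndecomposablePerm_iff, HasFirstBlock]
  refine and_congr_right fun _ => ?_
  rw [preservesInitial_permDirectSum_iff α β le_rfl, and_iff_right (preservesInitial_self α)]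
  exact forall_congr' fun i => forall_congr' fun _ => forall_congr' fun hi =>
    not_congr (preservesInitial_permDirectSum_iff α β hi.le)

section

variable (D : ∀ n, Equiv.Perm (Fin n) → Prop)

/-- Direct sum is a bijection from pairs (indecomposable, arbitrary) in the class onto its members
with first block of length `k`. -/
theorem card_hasFirstBlock {k m : ℕ}
    (hD : ∀ (α : Equiv.Perm (Fin k)) (β : Equiv.Perm (Fin m)),
      D (k + m) (permDirectSum α β) ↔ D k α ∧ D m β) :
    Nat.card {σ : Equiv.Perm (Fin (k + m)) // D (k + m) σ ∧ HasFirstBlock σ k} =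
      Nat.card {σ : Equiv.Perm (Fin k) // IsIndecomposablePerm σ ∧ D k σ} *
        Nat.card {σ : Equiv.Perm (Fin m) // D m σ} := by
  rw [← Nat.card_prod]
  symm
  refine Nat.card_congr (Equiv.ofBijective (fun p => ⟨permDirectSum p.1.1 p.2.1,
    (hD _ _).2 ⟨p.1.2.2, p.2.2⟩, (hasFirstBlock_permDirectSum_iff _ _).2 p.1.2.1⟩) ⟨?_, ?_⟩)
  · rintro ⟨⟨α, hα⟩, ⟨β, hβ⟩⟩ ⟨⟨α', hα'⟩, ⟨β', hβ'⟩⟩ h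
    have := @permDirectSum_injective k m (α, β) (α', β') (Subtype.ext_iff.1 h)
    rw [Prod.mk_inj] at this
    obtain ⟨rfl, rfl⟩ := this
    rfl
  · rintro ⟨σ, h1, h2⟩
    obtain ⟨α, β, rfl⟩ := exists_permDirectSum_eq h2.2.1
    exact ⟨⟨⟨α, (hasFirstBlock_permDirectSum_iff _ _).1 h2, ((hD _ _).1 h1).1⟩,
      ⟨β, ((hD _ _).1 h1).2⟩⟩, rfl⟩

/-- Decomposition of the permutations in a class that is closed under direct sums and under
passing to summands, by the first indecomposable block. -/
theorem card_eq_sum_indecomposable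
    (hD : ∀ k m (α : Equiv.Perm (Fin k)) (β : Equiv.Perm (Fin m)),
      D (k + m) (permDirectSum α β) ↔ D k α ∧ D m β) {n : ℕ} (hn : 0 < n) :
    Nat.card {σ : Equiv.Perm (Fin n) // D n σ} =
      ∑ p ∈ Finset.HasAntidiagonal.antidiagonal n,
        Nat.card {σ : Equiv.Perm (Fin p.1) // IsIndecomposablePerm σ ∧ D p.1 σ} *
          Nat.card {σ : Equiv.Perm (Fin p.2) // D p.2 σ} := by
  classical
  have h1 : ∀ p ∈ Finset.HasAntidiagonal.antidiagonal n,
      Nat.card {σ : Equiv.Perm (Fin p.1) // IsIndecomposablePerm σ ∧ D p.1 σ} *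
          Nat.card {σ : Equiv.Perm (Fin p.2) // D p.2 σ} =
      Nat.card {σ : Equiv.Perm (Fin n) // D n σ ∧ HasFirstBlock σ p.1} := by
    rintro ⟨k, m⟩ hp
    obtain rfl := Finset.HasAntidiagonal.mem_antidiagonal.1 hp
    exact (card_hasFirstBlock D (hD k m)).symm
  rw [Finset.sum_congr rfl h1]
  simp only [Nat.card_eq_fintype_card, Fintype.card_subtype]
  -- The class is partitioned by the length of the first block, paired with the length of the rest.
  rw [Finset.card_eq_sum_card_fiberwise (f := fun σ =>
    ((existsUnique_hasFirstBlock hn σ).choose, n - (existsUnique_hasFirstBlock hn σ).choose))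
    (t := Finset.HasAntidiagonal.antidiagonal n)]
  · refine Finset.sum_congr rfl fun p hp => congrArg Finset.card ?_
    rw [Finset.HasAntidiagonal.mem_antidiagonal] at hp
    ext σ
    obtain ⟨hc, hu⟩ := (existsUnique_hasFirstBlock hn σ).choose_spec
    simp only [Finset.mem_filter, Finset.mem_univ, true_and]
    refine and_congr_right fun _ => ⟨fun h => ?_, fun h => ?_⟩
    · rw [← h]; exact hc
    · have := hu _ h
      rw [← this]
      ext <;> simp
      omega
  · intro σ _
    obtain ⟨hc, hu⟩ := (existsUnique_hasFirstBlock hn σ).choose_spec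
    have := hc.le hn
    rw [Finset.mem_coe, Finset.HasAntidiagonal.mem_antidiagonal]
    exact Nat.add_sub_of_le this

end

/-! ### Reciprocal generating functions -/

theorem PowerSeries.mk_mul_mk_eq_one {a b c : ℕ → ℂ} (ha : a 0 = 1) (hc : c 0 = 0)
    (hb : ∀ n, b n = if n = 0 then 1 else -c n)
    (h : ∀ n, 0 < n → a n = ∑ p ∈ Finset.HasAntidiagonal.antidiagonal n, c p.1 * a p.2) :
    PowerSeries.mk a * PowerSeries.mk b = 1 := by
  have h1 : PowerSeries.mk b = 1 - PowerSeries.mk c := by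
    ext n
    rw [map_sub, PowerSeries.coeff_mk, PowerSeries.coeff_mk, PowerSeries.coeff_one, hb]
    split_ifs with hn
    · rw [hn, hc, sub_zero]
    · rw [zero_sub]
  have h2 : PowerSeries.mk a = 1 + PowerSeries.mk c * PowerSeries.mk a := by
    ext n
    rw [map_add, PowerSeries.coeff_mul, PowerSeries.coeff_one]
    simp only [PowerSeries.coeff_mk]
    rcases Nat.eq_zero_or_pos n with rfl | hn
    · simp [ha, hc]
    · rw [if_neg hn.ne', zero_add, h n hn]
  rw [h1]
  linear_combination h2

theorem mk_factorial_mul_mk_numIndecomposablePerms :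
    PowerSeries.mk (fun n => (n.factorial : ℂ)) *
      PowerSeries.mk (fun n => if n = 0 then 1 else -(numIndecomposablePerms n : ℂ)) = 1 := by
  refine PowerSeries.mk_mul_mk_eq_one (c := fun n => (numIndecomposablePerms n : ℂ)) (by simp) ?_
    (fun n => rfl) fun n hn => ?_
  · simp [numIndecomposablePerms, IsIndecomposablePerm]
  · have := card_eq_sum_indecomposable (fun _ _ => True) (by simp) hn
    simp only [and_true] at this
    have hc : ∀ n : ℕ, Nat.card {σ : Equiv.Perm (Fin n) // True} = n.factorial := fun n => by
      rw [Nat.card_congr (Equiv.subtypeUnivEquiv fun _ => trivial), Nat.card_perm, Nat.card_fin]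
    simp only [hc] at this
    rw [this]
    push_cast
    rfl

/-- A direct sum is a derangement exactly when both summands are, so the block decomposition
applies. The convention `-1` at `n = 0` supplies the constant term `1` of the reciprocal. -/
theorem mk_numDerangements_mul_mk_numIndecomposableDerangements :
    PowerSeries.mk (fun n => (numDerangements n : ℂ)) *
      PowerSeries.mk (fun n => -(numIndecomposableDerangements n : ℂ)) = 1 := by
  refine PowerSeries.mk_mul_mk_eq_one (c := fun n => (Nat.card {σ : Equiv.Perm (Fin n) //
    IsIndecomposablePerm σ ∧ σ ∈ derangements (Fin n)} : ℂ)) (by simp) ?_ (fun n => ?_)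
    fun n hn => ?_
  · simp [IsIndecomposablePerm]
  · rw [numIndecomposableDerangements]
    split_ifs <;> simp
  · have := card_eq_sum_indecomposable (fun n σ => σ ∈ derangements (Fin n))
      (fun _ _ α β => permDirectSum_mem_derangements_iff α β) hn
    have hc : ∀ n : ℕ, Nat.card {σ : Equiv.Perm (Fin n) // σ ∈ derangements (Fin n)} =
        numDerangements n := fun n => by
      rw [← card_derangements_fin_eq_numDerangements, ← Nat.card_eq_fintype_card]
    simp only [hc] at this
    rw [this]
    push_cast
    rfl

/-! ### The principal value and derivative of the logarithmic integral -/

/-- Subtracting `1 / (t - 1)` removes the pole at `1`. The bound comes from `log t ≤ t - 1 ≤ t log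
t`; at `t = 0` and `t = 1` it holds by the conventions for `log 0` and division by zero. -/
theorem abs_one_div_log_sub_le {t : ℝ} (ht : 0 ≤ t) :
    |1 / Real.log t - 1 / (t - 1)| ≤ 1 := by
  rcases ht.eq_or_lt with rfl | ht0
  · simp
  rcases lt_trichotomy t 1 with h1 | rfl | h1
  · have hl : Real.log t < 0 := Real.log_neg ht0 h1
    have h2 := Real.log_le_sub_one_of_pos ht0
    have h3 := Real.one_sub_inv_le_log_of_pos ht0
    have h4 : t * Real.log t ≥ t - 1 := by
      have := mul_le_mul_of_nonneg_left h3 ht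
      rwa [mul_sub, mul_one, mul_inv_cancel₀ ht0.ne'] at this
    have hp : 0 < Real.log t * (t - 1) := mul_pos_of_neg_of_neg hl (by linarith)
    rw [div_sub_div _ _ hl.ne (by linarith), abs_div, abs_of_pos hp, div_le_one hp, abs_le]
    constructor <;> nlinarith
  · simp
  · have hl : 0 < Real.log t := Real.log_pos h1
    have h2 := Real.log_le_sub_one_of_pos ht0
    have h3 := Real.one_sub_inv_le_log_of_pos ht0
    have h4 : t * Real.log t ≥ t - 1 := by
      have := mul_le_mul_of_nonneg_left h3 ht
      rwa [mul_sub, mul_one, mul_inv_cancel₀ ht0.ne'] at this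
    have hp : 0 < Real.log t * (t - 1) := mul_pos hl (by linarith)
    rw [div_sub_div _ _ hl.ne' (by linarith), abs_div, abs_of_pos hp, div_le_one hp, abs_le]
    constructor <;> nlinarith

open MeasureTheory in
theorem integrableOn_one_div_log_sub (x : ℝ) :
    IntegrableOn (fun t : ℝ => 1 / Real.log t - 1 / (t - 1)) (Set.Icc 0 x) := by
  refine Measure.integrableOn_of_bounded (M := 1) (by simp) (by fun_prop) ?_
  exact (ae_restrict_iff' measurableSet_Icc).2 (Eventually.of_forall fun t ht =>
    abs_one_div_log_sub_le ht.1)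

theorem Icc_diff_Ioo_eq {x ε : ℝ} (hε : 0 < ε) (hε1 : ε < 1) (hεx : ε < x - 1) :
    Set.Icc 0 x \ Set.Ioo (1 - ε) (1 + ε) = Set.Icc 0 (1 - ε) ∪ Set.Icc (1 + ε) x := by
  ext t
  simp only [Set.mem_sdiff, Set.mem_Icc, Set.mem_Ioo, not_and, not_lt, Set.mem_union]
  constructor
  · rintro ⟨⟨h1, h2⟩, h3⟩
    rcases le_or_gt t (1 - ε) with h | h
    · exact Or.inl ⟨h1, h⟩
    · exact Or.inr ⟨h3 h, h2⟩
  · rintro (⟨h1, h2⟩ | ⟨h1, h2⟩)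
    · exact ⟨⟨h1, by linarith⟩, fun h => absurd h (by linarith)⟩
    · exact ⟨⟨by linarith, h2⟩, fun _ => h1⟩

-- The two pieces contribute `log ε` and `log ((x - 1) / ε)`; the symmetric truncation makes `ε`
-- cancel.
open MeasureTheory in
theorem integral_one_div_sub_one_truncated {x ε : ℝ} (hε : 0 < ε) (hε1 : ε < 1)
    (hεx : ε < x - 1) :
    IntegrableOn (fun t : ℝ => 1 / (t - 1)) (Set.Icc 0 x \ Set.Ioo (1 - ε) (1 + ε)) ∧
    ∫ t in Set.Icc 0 x \ Set.Ioo (1 - ε) (1 + ε), 1 / (t - 1) = Real.log (x - 1) := by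
  have hc : ∀ s : Set ℝ, (∀ t ∈ s, t ≠ 1) → ContinuousOn (fun t : ℝ => 1 / (t - 1)) s :=
    fun s hs => continuousOn_const.div (by fun_prop) fun t ht => sub_ne_zero.2 (hs t ht)
  have hi1 : IntegrableOn (fun t : ℝ => 1 / (t - 1)) (Set.Icc 0 (1 - ε)) :=
    (hc _ fun t ht => by have := ht.2; intro h; linarith).integrableOn_compact isCompact_Icc
  have hi2 : IntegrableOn (fun t : ℝ => 1 / (t - 1)) (Set.Icc (1 + ε) x) :=
    (hc _ fun t ht => by have := ht.1; intro h; linarith).integrableOn_compact isCompact_Icc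
  rw [Icc_diff_Ioo_eq hε hε1 hεx]
  refine ⟨hi1.union hi2, ?_⟩
  rw [setIntegral_union ?_ measurableSet_Icc hi1 hi2]
  · rw [integral_Icc_eq_integral_Ioc, integral_Icc_eq_integral_Ioc,
      ← intervalIntegral.integral_of_le (by linarith), ← intervalIntegral.integral_of_le
      (by linarith), intervalIntegral.integral_comp_sub_right (fun t => 1 / t),
      intervalIntegral.integral_comp_sub_right (fun t => 1 / t), integral_one_div,
      integral_one_div, ← Real.log_mul]
    · congr 1
      rw [zero_sub, sub_sub_cancel_left, add_sub_cancel_left, neg_div_neg_eq, div_one,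
        mul_div_cancel₀ _ hε.ne']
    · have : (0 : ℝ) - 1 ≠ 0 := by norm_num
      refine div_ne_zero (by linarith) this
    · exact div_ne_zero (by linarith) (by linarith)
    · rw [Set.uIcc_of_le (by linarith)]
      rintro ⟨h, -⟩
      linarith
    · rw [Set.uIcc_of_le (by linarith)]
      rintro ⟨-, h⟩
      linarith
  · rw [Set.disjoint_left]
    rintro t ⟨-, h1⟩ ⟨h2, -⟩
    linarith

open MeasureTheory in
/-- The principal value defining `li x` exists for `x > 1`, and equals a convergent integral. -/
theorem logIntegral_eq {x : ℝ} (hx : 1 < x) :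
    logIntegral x = (∫ t in (0 : ℝ)..x, (1 / Real.log t - 1 / (t - 1))) + Real.log (x - 1) := by
  set g : ℝ → ℝ := fun t => 1 / Real.log t - 1 / (t - 1) with hg
  have hgi := integrableOn_one_div_log_sub x
  have hev : ∀ᶠ ε in 𝓝[>] (0 : ℝ), 0 < ε ∧ ε < 1 ∧ ε < x - 1 :=
    (eventually_mem_nhdsWithin).and (((eventually_lt_nhds one_pos).and
      (eventually_lt_nhds (sub_pos.2 hx))).filter_mono nhdsWithin_le_nhds)
  have hlim : Tendsto (fun ε : ℝ => ∫ t in Set.Icc 0 x \ Set.Ioo (1 - ε) (1 + ε), g t)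
      (𝓝[>] 0) (𝓝 (∫ t in Set.Icc 0 x, g t)) := by
    rw [tendsto_iff_norm_sub_tendsto_zero]
    -- Bound `1` on the integrand times the length `2ε` of the removed interval.
    have h2 : Tendsto (fun ε : ℝ => 1 * (2 * ε)) (𝓝[>] 0) (𝓝 0) := by
      have : Tendsto (fun ε : ℝ => 1 * (2 * ε)) (𝓝 0) (𝓝 (1 * (2 * 0))) := by
        apply Continuous.tendsto; fun_prop
      simpa using this.mono_left nhdsWithin_le_nhds
    refine squeeze_zero' (Eventually.of_forall fun _ => norm_nonneg _) ?_ h2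
    filter_upwards [hev] with ε ⟨h0, h1, hεx⟩
    have hsub : Set.Ioo (1 - ε) (1 + ε) ⊆ Set.Icc 0 x := fun t ht =>
      ⟨by linarith [ht.1], by linarith [ht.2]⟩
    rw [setIntegral_sdiff measurableSet_Ioo hgi hsub, sub_sub_cancel_left, norm_neg]
    refine (norm_setIntegral_le_of_norm_le_const (C := 1) (by simp) fun t ht =>
      abs_one_div_log_sub_le (hsub ht).1).trans ?_
    rw [Measure.real, Real.volume_Ioo, ENNReal.toReal_ofReal (by linarith)]
    linarith
  refine Tendsto.limUnder_eq ?_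
  rw [intervalIntegral.integral_of_le (by linarith), ← integral_Icc_eq_integral_Ioc]
  refine (hlim.add_const _).congr' ?_
  filter_upwards [hev] with ε ⟨h0, h1, hεx⟩
  obtain ⟨hi, he⟩ := integral_one_div_sub_one_truncated h0 h1 hεx
  rw [← he, ← integral_add (hgi.mono_set Set.sdiff_subset) hi]
  simp only [sub_add_cancel]

theorem hasDerivAt_logIntegral {x : ℝ} (hx : 1 < x) :
    HasDerivAt logIntegral (1 / Real.log x) x := by
  have h1 : HasDerivAt (fun x : ℝ => ∫ t in (0 : ℝ)..x, (1 / Real.log t - 1 / (t - 1)))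
      (1 / Real.log x - 1 / (x - 1)) x := by
    refine intervalIntegral.integral_hasDerivAt_right ?_ ?_ ?_
    · rw [intervalIntegrable_iff_integrableOn_Icc_of_le (by linarith)]
      exact integrableOn_one_div_log_sub x
    · exact Measurable.stronglyMeasurable (by fun_prop) |>.stronglyMeasurableAtFilter
    · have hl : Real.log x ≠ 0 := (Real.log_pos hx).ne'
      have hx1 : x - 1 ≠ 0 := by linarith
      have hx0 : x ≠ 0 := by linarith
      exact (continuousAt_const.div (Real.continuousAt_log hx0) hl).sub
        (continuousAt_const.div (by fun_prop) hx1)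
  have h2 : HasDerivAt (fun x : ℝ => Real.log (x - 1)) (1 / (x - 1)) x :=
    ((hasDerivAt_id x).sub_const 1).log (by simp; linarith)
  have h3 := h1.add h2
  rw [sub_add_cancel] at h3
  refine h3.congr_of_eventuallyEq ?_
  filter_upwards [eventually_gt_nhds hx] with y hy
  exact logIntegral_eq hy

/-! ### The differential equation and its expansion at infinity -/

/-- Solutions of `R' + R = E` inherit a bound `O(u ^ (-M))` from the right hand side. -/
theorem isBigO_of_hasDerivAt {R E : ℝ → ℝ} {M : ℕ}
    (hR : ∀ᶠ u in atTop, HasDerivAt R (E u - R u) u)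
    (hE : E =O[atTop] fun u : ℝ => u⁻¹ ^ M) : R =O[atTop] fun u : ℝ => u⁻¹ ^ M := by
  obtain ⟨C, hC0, hC⟩ := hE.exists_pos
  obtain ⟨A, hA⟩ := eventually_atTop.1 (hR.and hC.bound)
  -- From here on `1 - M/u ≥ 1/2`, so the derivative of `2 C e^u u^(-M)` dominates `C e^u u^(-M)`,
  -- which bounds `(e^u R)' = e^u E`. The summand `1` keeps `u₀` positive.
  set u₀ : ℝ := max A (2 * M + 1) with hu₀
  have hu₀M : 2 * (M : ℝ) + 1 ≤ u₀ := le_max_right _ _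
  have hM0 : (0 : ℝ) ≤ M := M.cast_nonneg
  have hder : ∀ u, u₀ ≤ u → HasDerivAt (fun u => Real.exp u * R u) (Real.exp u * E u) u :=
    fun u hu => by
      exact ((Real.hasDerivAt_exp u).fun_mul
        (hA u ((le_max_left _ _).trans hu)).1).congr_deriv (by ring)
  have hB : ∀ u, u₀ ≤ u → HasDerivAt
      (fun u => ‖Real.exp u₀ * R u₀‖ + 2 * C * (Real.exp u * u⁻¹ ^ M))
      (2 * C * (Real.exp u * u⁻¹ ^ M * (1 - M * u⁻¹))) u := fun u hu => by
    have hu0 : u ≠ 0 := by linarith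
    refine ((((Real.hasDerivAt_exp u).fun_mul ((hasDerivAt_inv hu0).fun_pow M)).const_mul
      (2 * C)).const_add ‖Real.exp u₀ * R u₀‖).congr_deriv ?_
    rcases M with _ | M
    · simp
    · simp only [Nat.add_sub_cancel, ← inv_pow]
      ring
  have hbound : ∀ u, u₀ ≤ u →
      ‖Real.exp u * R u‖ ≤ ‖Real.exp u₀ * R u₀‖ + 2 * C * (Real.exp u * u⁻¹ ^ M) := by
    intro u hu
    refine image_norm_le_of_norm_deriv_right_le_deriv_boundary' (a := u₀) (b := u)
      (fun v hv => (hder v hv.1).continuousAt.continuousWithinAt)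
      (fun v hv => (hder v hv.1).hasDerivWithinAt) ?_
      (fun v hv => (hB v hv.1).continuousAt.continuousWithinAt)
      (fun v hv => (hB v hv.1).hasDerivWithinAt) ?_ ⟨hu, le_rfl⟩
    · have : (0 : ℝ) ≤ u₀⁻¹ := inv_nonneg.2 (by linarith)
      have : 0 ≤ 2 * C * (Real.exp u₀ * u₀⁻¹ ^ M) := by positivity
      linarith
    · intro v hv
      have hv0 : 0 < v := by linarith [hv.1]
      have h1 := (hA v ((le_max_left _ _).trans hv.1)).2
      rw [norm_mul, Real.norm_of_nonneg (Real.exp_pos v).le]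
      rw [Real.norm_of_nonneg (show (0 : ℝ) ≤ v⁻¹ ^ M by positivity)] at h1
      have h2 : (1 : ℝ) / 2 ≤ 1 - M * v⁻¹ := by
        have : (M : ℝ) * v⁻¹ ≤ 1 / 2 := by
          rw [← div_eq_mul_inv, div_le_iff₀ hv0]
          linarith [hv.1]
        linarith
      calc Real.exp v * ‖E v‖ ≤ Real.exp v * (C * v⁻¹ ^ M) := by gcongr
        _ = 2 * C * (Real.exp v * v⁻¹ ^ M * (1 / 2)) := by ring
        _ ≤ _ := by gcongr
  have hexp : (fun u : ℝ => ‖Real.exp u₀ * R u₀‖ * Real.exp (-u)) =O[atTop]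
      fun u : ℝ => u⁻¹ ^ M := by
    refine IsBigO.const_mul_left ?_ _
    have h := (Real.tendsto_pow_mul_exp_neg_atTop_nhds_zero M).isBigO_one ℝ
    have h' := h.mul (isBigO_refl (fun u : ℝ => u⁻¹ ^ M) atTop)
    refine h'.congr' ?_ (Eventually.of_forall fun u => one_mul _)
    filter_upwards [eventually_gt_atTop 0] with u hu
    rw [mul_right_comm, ← mul_pow, mul_inv_cancel₀ hu.ne', one_pow, one_mul]
  refine IsBigO.trans ?_ (hexp.add ((isBigO_refl (fun u : ℝ => u⁻¹ ^ M) atTop).const_mul_left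
    (2 * C)))
  refine IsBigO.of_bound 1 ?_
  filter_upwards [eventually_ge_atTop u₀] with u hu
  have hu0 : 0 < u := by linarith
  have h := hbound u hu
  rw [norm_mul, Real.norm_of_nonneg (Real.exp_pos u).le] at h
  rw [one_mul]
  refine le_trans ?_ (le_abs_self _)
  rw [Real.exp_neg]
  have he := Real.exp_pos u
  refine le_of_mul_le_mul_left (h.trans_eq ?_) he
  field_simp

theorem hasDerivAt_sum_inv_pow (a : ℕ → ℝ) (N : ℕ) {u : ℝ} (hu : u ≠ 0) :
    HasDerivAt (fun u : ℝ => ∑ n ∈ Finset.range N, a n * u⁻¹ ^ (n + 1))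
      (-∑ n ∈ Finset.range N, (n + 1) * a n * u⁻¹ ^ (n + 2)) u := by
  rw [← Finset.sum_neg_distrib]
  refine HasDerivAt.fun_sum fun n _ => ?_
  refine (((hasDerivAt_inv hu).fun_pow (n + 1)).const_mul (a n)).congr_deriv ?_
  simp only [Nat.add_sub_cancel, Nat.cast_add, Nat.cast_one, ← inv_pow]
  ring

theorem isBigO_inv_add (c : ℝ) : (fun u : ℝ => (u + c)⁻¹) =O[atTop] fun u : ℝ => u⁻¹ := by
  refine IsBigO.of_bound 2 ?_
  filter_upwards [eventually_gt_atTop 0, eventually_ge_atTop (-2 * c)] with u hu huc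
  have h2 : u / 2 ≤ u + c := by linarith
  rw [Real.norm_of_nonneg (inv_nonneg.2 (by linarith)), Real.norm_of_nonneg
    (inv_nonneg.2 hu.le)]
  calc (u + c)⁻¹ ≤ (u / 2)⁻¹ := inv_anti₀ (by positivity) h2
    _ = 2 * u⁻¹ := by field_simp

/-- The expansion at infinity of solutions of `F' + F = 1 / (u + c)`. -/
theorem isBigO_sub_sum_of_hasDerivAt {F : ℝ → ℝ} {c : ℝ} {a : ℕ → ℝ}
    (hF : ∀ᶠ u in atTop, HasDerivAt F (1 / (u + c) - F u) u) (ha0 : a 0 = 1)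
    (ha : ∀ n, a (n + 1) = (n + 1) * a n + (-c) ^ (n + 1)) (N : ℕ) :
    (fun u => F u - ∑ n ∈ Finset.range N, a n * u⁻¹ ^ (n + 1)) =O[atTop]
      fun u : ℝ => u⁻¹ ^ (N + 1) := by
  -- Residual of the truncated series in the differential equation: by the recursion for `a` it
  -- collapses to two terms, both `O(u^(-N-1))`.
  have hE : ∀ᶠ u : ℝ in atTop, 1 / (u + c) - ∑ n ∈ Finset.range N, a n * u⁻¹ ^ (n + 1) +
      ∑ n ∈ Finset.range N, (n + 1) * a n * u⁻¹ ^ (n + 2) =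
      (-c) ^ N * u⁻¹ ^ N / (u + c) + (a N - (-c) ^ N) * u⁻¹ ^ (N + 1) := by
    filter_upwards [eventually_gt_atTop 0, eventually_gt_atTop (-c)] with u hu huc
    have huc' : u + c ≠ 0 := by linarith
    induction N with
    | zero => simp [ha0]
    | succ N ih =>
      rw [Finset.sum_range_succ, Finset.sum_range_succ, ha]
      have h1 : 1 / (u + c) - (∑ n ∈ Finset.range N, a n * u⁻¹ ^ (n + 1) +
          a N * u⁻¹ ^ (N + 1)) + (∑ n ∈ Finset.range N, (n + 1) * a n * u⁻¹ ^ (n + 2) +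
          (N + 1) * a N * u⁻¹ ^ (N + 2)) =
          (1 / (u + c) - ∑ n ∈ Finset.range N, a n * u⁻¹ ^ (n + 1) +
          ∑ n ∈ Finset.range N, (n + 1) * a n * u⁻¹ ^ (n + 2)) - a N * u⁻¹ ^ (N + 1) +
          (N + 1) * a N * u⁻¹ ^ (N + 2) := by ring
      rw [h1, ih]
      simp only [inv_pow]
      field_simp
      ring
  refine isBigO_of_hasDerivAt (E := fun u => (-c) ^ N * u⁻¹ ^ N / (u + c) +
    (a N - (-c) ^ N) * u⁻¹ ^ (N + 1)) ?_ ?_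
  · filter_upwards [hF, hE, eventually_gt_atTop 0] with u h1 h2 h3
    refine (h1.fun_sub (hasDerivAt_sum_inv_pow a N h3.ne')).congr_deriv ?_
    rw [← h2]
    ring
  · refine IsBigO.add ?_ ((isBigO_refl _ _).const_mul_left _)
    have h2 := ((isBigO_refl (fun u : ℝ => u⁻¹ ^ N) atTop).mul (isBigO_inv_add c)).const_mul_left ((-c) ^ N)
    refine h2.congr (fun u => ?_) fun u => (pow_succ _ _).symm
    rw [div_eq_mul_inv, mul_assoc]

theorem hasDerivAt_logIntegral_exp (c : ℝ) : ∀ᶠ u in atTop, HasDerivAt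
    (fun u => logIntegral (Real.exp (u + c)) / Real.exp (u + c))
    (1 / (u + c) - logIntegral (Real.exp (u + c)) / Real.exp (u + c)) u := by
  filter_upwards [eventually_gt_atTop (-c)] with u hu
  have huc : 0 < u + c := by linarith
  have h1 : HasDerivAt (fun u => Real.exp (u + c)) (Real.exp (u + c)) u := by
    simpa using ((hasDerivAt_id u).add_const c).exp
  have h2 := (hasDerivAt_logIntegral (Real.one_lt_exp_iff.2 huc)).comp u h1
  refine (h2.fun_div h1 (Real.exp_pos _).ne').congr_deriv ?_
  rw [Real.log_exp]
  simp only [Function.comp]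
  field_simp

/-- The expansion of `li (e ^ c * x) / (e ^ c * x)` in terms of `log x`. -/
theorem hasPowerExpansion_logIntegral {c : ℝ} {a : ℕ → ℝ} (ha0 : a 0 = 1)
    (ha : ∀ n, a (n + 1) = (n + 1) * a n + (-c) ^ (n + 1)) :
    HasPowerExpansion atTop (fun x : ℝ => (Real.log x : ℂ)⁻¹)
      (fun x => ((logIntegral (Real.exp c * x) / (Real.exp c * x) : ℝ) : ℂ) * Real.log x)
      (fun n => (a n : ℂ)) := by
  intro N
  have h1 := (isBigO_sub_sum_of_hasDerivAt (hasDerivAt_logIntegral_exp c) ha0 ha N).comp_tendsto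
    Real.tendsto_log_atTop
  have h2 := h1.mul (isBigO_refl Real.log atTop)
  refine IsBigO.of_norm_norm (h2.norm_norm.congr' ?_ ?_)
  · filter_upwards [eventually_gt_atTop 1] with x hx
    have hx0 : 0 < x := by linarith
    have hl : Real.log x ≠ 0 := (Real.log_pos hx).ne'
    rw [← Complex.norm_real]
    simp only [Function.comp, Real.exp_add, Real.exp_log hx0, mul_comm x (Real.exp c)]
    push_cast
    rw [sub_mul, Finset.sum_mul]
    refine congrArg norm (congrArg₂ (· - ·) rfl (Finset.sum_congr rfl fun n _ => ?_))
    have hl' : (Real.log x : ℂ) ≠ 0 := by exact_mod_cast hl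
    rw [pow_succ, mul_assoc, mul_assoc, inv_mul_cancel₀ hl', mul_one]
  · filter_upwards [eventually_gt_atTop 1] with x hx
    have hl : Real.log x ≠ 0 := (Real.log_pos hx).ne'
    simp only [Function.comp, pow_succ, mul_assoc, inv_mul_cancel₀ hl, mul_one]
    rw [← Complex.norm_real]
    push_cast
    rfl

/-! ### Transfer to the approximations `L` and `P` -/

theorem isBigO_inv_log_pow_of_isLittleO {G : ℝ → ℂ}
    (h : ∀ t : ℝ, G =o[atTop] fun x : ℝ => Real.log x ^ t) (N : ℕ) :
    G =O[atTop] fun x : ℝ => (Real.log x : ℂ)⁻¹ ^ N := by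
  refine (h (-N)).isBigO.trans (IsBigO.of_bound 1 ?_)
  filter_upwards [eventually_gt_atTop 1] with x hx
  have hl := Real.log_pos hx
  rw [Real.rpow_neg hl.le, Real.rpow_natCast, one_mul, norm_inv, norm_pow, norm_pow, norm_inv,
    Complex.norm_real, inv_pow]

theorem tendsto_inv_log : Tendsto (fun x : ℝ => (Real.log x : ℂ)⁻¹) atTop (𝓝 0) := by
  have h := (Complex.continuous_ofReal.tendsto 0).comp
    (tendsto_inv_atTop_zero.comp Real.tendsto_log_atTop)
  simpa [Function.comp_def] using h

theorem eventually_log_ne_zero : ∀ᶠ x : ℝ in atTop, (Real.log x : ℂ) ≠ 0 := by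
  filter_upwards [eventually_gt_atTop 1] with x hx
  exact_mod_cast (Real.log_pos hx).ne'

section

variable {L P : ℝ → ℂ}

theorem tendsto_inv_of_isLittleO_log
    (hL : ∀ t : ℝ, (fun x : ℝ => L x - (Real.log x : ℂ)) =o[atTop] fun x : ℝ => Real.log x ^ t) :
    Tendsto (fun x => (L x)⁻¹) atTop (𝓝 0) ∧ ∀ᶠ x in atTop, (L x)⁻¹ ≠ 0 := by
  have h0 : Tendsto (fun x => L x - (Real.log x : ℂ)) atTop (𝓝 0) :=
    (isBigO_inv_log_pow_of_isLittleO hL 1).trans_tendsto (by simpa using tendsto_inv_log)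
  have h1 : Tendsto (fun x => L x * (Real.log x : ℂ)⁻¹) atTop (𝓝 1) := by
    have h := (h0.mul tendsto_inv_log).add_const 1
    simp only [mul_zero, zero_add] at h
    refine h.congr' ?_
    filter_upwards [eventually_log_ne_zero] with x hx
    field_simp
    ring
  constructor
  · have h := tendsto_inv_log.mul (h1.inv₀ one_ne_zero)
    rw [zero_mul] at h
    refine h.congr' ?_
    filter_upwards [eventually_log_ne_zero] with x hx
    rw [mul_inv, inv_inv, mul_comm, mul_assoc, mul_inv_cancel₀ hx, mul_one]
  · filter_upwards [h1.eventually_ne one_ne_zero] with x hx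
    exact inv_ne_zero (left_ne_zero_of_mul hx)

/-- The expansion of `P (e ^ c * x) * L x` in powers of `1 / L x`, for approximations `L` of the
logarithm and `P` of `li x / x` beyond all orders. -/
theorem hasPowerExpansion_of_isLittleO
    (hL : ∀ t : ℝ, (fun x : ℝ => L x - (Real.log x : ℂ)) =o[atTop] fun x : ℝ => Real.log x ^ t)
    (hP : ∀ t : ℝ,
      (fun x : ℝ => P x - ((logIntegral x / x : ℝ) : ℂ)) =o[atTop] fun x : ℝ => Real.log x ^ t)
    {c : ℝ} {a : ℕ → ℝ} (ha0 : a 0 = 1)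
    (ha : ∀ n, a (n + 1) = (n + 1) * a n + (-c) ^ (n + 1)) :
    HasPowerExpansion atTop (fun x => (L x)⁻¹) (fun x => P (Real.exp c * x) * L x)
      (fun n => (a n : ℂ)) := by
  have hF := hasPowerExpansion_logIntegral ha0 ha
  have hL' := isBigO_inv_log_pow_of_isLittleO hL
  have hP' : ∀ N : ℕ, (fun x : ℝ => P (Real.exp c * x) -
      ((logIntegral (Real.exp c * x) / (Real.exp c * x) : ℝ) : ℂ)) =O[atTop]
      fun x : ℝ => (Real.log x : ℂ)⁻¹ ^ N := fun N => by
    have h1 := (isBigO_inv_log_pow_of_isLittleO hP N).comp_tendsto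
      (tendsto_id.const_mul_atTop (Real.exp_pos c))
    -- The error at `e^c x` is measured by `log x + c`, which is comparable with `log x`.
    refine h1.trans (IsBigO.pow (f := fun x : ℝ => (Real.log (Real.exp c * x) : ℂ)⁻¹) ?_ N)
    have h2 := (isBigO_inv_add c).comp_tendsto Real.tendsto_log_atTop
    refine IsBigO.of_norm_norm (h2.norm_norm.congr' ?_ (Eventually.of_forall fun x => ?_))
    · filter_upwards [eventually_gt_atTop 0] with x hx
      rw [Real.log_mul (Real.exp_pos c).ne' hx.ne', Real.log_exp, norm_inv, Complex.norm_real,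
        ← norm_inv, add_comm c]
      rfl
    · simp only [Function.comp, norm_inv, Complex.norm_real]
  refine hF.perturb tendsto_inv_log (fun N => ?_) fun N => ?_
  -- With `p`, `ℓ` for the exact quotient and logarithm, `P L - p ℓ = (P - p)(L - ℓ) + (P - p) ℓ + p
  -- (L - ℓ)`. The factor `ℓ` costs one power, hence `N + 1`; in the last term `p = (p ℓ) ℓ⁻¹` is
  -- bounded.
  · have h1 := (hP' N).mul (hL' 0)
    have h2 := (hP' (N + 1)).mul (isBigO_refl (fun x : ℝ => (Real.log x : ℂ)) atTop)
    have h3 := ((hF.tendsto tendsto_inv_log).isBigO_one ℂ).mul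
      ((tendsto_inv_log.isBigO_one ℂ).mul (hL' N))
    simp only [pow_zero, mul_one, one_mul] at h1 h3
    have h2' := h2.congr' EventuallyEq.rfl (g₂ := fun x : ℝ => (Real.log x : ℂ)⁻¹ ^ N) (by
      filter_upwards [eventually_log_ne_zero] with x hx
      rw [pow_succ, inv_mul_cancel_right₀ hx])
    refine ((h1.add h2').add h3).congr' ?_ EventuallyEq.rfl
    filter_upwards [eventually_log_ne_zero] with x hx
    have hx' : (Real.log x : ℂ) * (Real.log x : ℂ)⁻¹ = 1 := mul_inv_cancel₀ hx
    linear_combination (((logIntegral (Real.exp c * x) / (Real.exp c * x) : ℝ) : ℂ) *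
      (L x - Real.log x)) * hx'
  · obtain ⟨hz, hz0⟩ := tendsto_inv_of_isLittleO_log hL
    have h := ((hL' N).neg_left.mul (hz.isBigO_one ℂ)).mul (tendsto_inv_log.isBigO_one ℂ)
    simp only [mul_one] at h
    refine h.congr' ?_ EventuallyEq.rfl
    filter_upwards [hz0, eventually_log_ne_zero] with x hx hx'
    have : L x ≠ 0 := by simpa using hx
    field_simp
    ring

end

/-! ### The seven expansions -/

theorem HasPowerExpansion.hasAsymptoticExpansion_one_div {α : Type*} {l : Filter α}
    {L f : α → ℂ} {a : ℕ → ℂ}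
    (hf : HasPowerExpansion l (fun x => (L x)⁻¹) (fun x => f x * L x) a)
    (hz : Tendsto (fun x => (L x)⁻¹) l (𝓝 0)) (hz0 : ∀ᶠ x in l, (L x)⁻¹ ≠ 0) :
    HasAsymptoticExpansion l f a (fun n x => 1 / L x ^ (n + 1)) := by
  refine (hf.hasAsymptoticExpansion hz).of_mul (h := fun x => (L x)⁻¹) ?_
    (Eventually.of_forall fun x n => ?_)
  · filter_upwards [hz0] with x hx
    have : L x ≠ 0 := by simpa using hx
    field_simp
  · rw [one_div, ← inv_pow, pow_succ']

theorem numArrangements_succ (n : ℕ) :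
    numArrangements (n + 1) = (n + 1) * numArrangements n + 1 := by
  have h : ((n + 1).factorial : ℚ) ≠ 0 := by exact_mod_cast (n + 1).factorial_ne_zero
  rw [numArrangements, Finset.sum_range_succ, mul_add, mul_one_div_cancel h, numArrangements,
    Nat.factorial_succ]
  push_cast
  ring

theorem corollary7p6 (L P : ℝ → ℂ)
    (hL : ∀ t : ℝ, (fun x : ℝ => L x - (Real.log x : ℂ)) =o[atTop] fun x : ℝ => Real.log x ^ t)
    (hP : ∀ t : ℝ,
      (fun x : ℝ => P x - ((logIntegral x / x : ℝ) : ℂ)) =o[atTop] fun x : ℝ => Real.log x ^ t) :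
    -- `P(x) ∼ ∑_{n ≥ 1} (n-1)! / L(x)^n`
    HasAsymptoticExpansion atTop P
      (fun n => (n.factorial : ℂ)) (fun n x => 1 / L x ^ (n + 1)) ∧
    -- `P(e x) ∼ ∑_{n ≥ 1} D_{n-1} / L(x)^n`
    HasAsymptoticExpansion atTop (fun x => P (Real.exp 1 * x))
      (fun n => (numDerangements n : ℂ)) (fun n x => 1 / L x ^ (n + 1)) ∧
    -- `P(x / e) ∼ ∑_{n ≥ 1} A_{n-1} / L(x)^n`
    HasAsymptoticExpansion atTop (fun x => P (x / Real.exp 1))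
      (fun n => (numArrangements n : ℂ)) (fun n x => 1 / L x ^ (n + 1)) ∧
    -- `L(x) - 1 / P(x) ∼ ∑_{n ≥ 0} I_{n+1} / L(x)^n`
    HasAsymptoticExpansion atTop (fun x => L x - 1 / P x)
      (fun n => (numIndecomposablePerms (n + 1) : ℂ)) (fun n x => 1 / L x ^ n) ∧
    -- `1 / P(e x) ∼ - ∑_{n ≥ -1} D'_{n+1} / L(x)^n`, where the index `n` is `m - 1`, `m ≥ 0`
    HasAsymptoticExpansion atTop (fun x => 1 / P (Real.exp 1 * x))
      (fun m => -(numIndecomposableDerangements m : ℂ)) (fun m x => 1 / L x ^ ((m : ℤ) - 1)) ∧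
    -- `P(x) ∼ 1 / (L(x) - 1 - 1 / (L(x) - 3 - 4 / (L(x) - 5 - 9 / (L(x) - 7 - ⋯))))`
    HasAsymptoticContFract atTop P
      (fun k _ => if k = 0 then 1 else -(k : ℂ) ^ 2)
      (fun k x => L x - (2 * (k : ℂ) + 1)) ∧
    -- `P(x) ∼ 1 / (L(x) - 1 / (1 - 1 / (L(x) - 2 / (1 - 2 / (L(x) - ⋯)))))`
    HasAsymptoticContFract atTop P
      (fun k _ => if k = 0 then 1 else -(((k + 1) / 2 : ℕ) : ℂ))
      (fun k x => if Even k then L x else 1) := by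
  obtain ⟨hz, hz0⟩ := tendsto_inv_of_isLittleO_log hL
  have h0 : HasPowerExpansion atTop (fun x => (L x)⁻¹) (fun x => P x * L x)
      (fun n => (n.factorial : ℂ)) := by
    simpa using hasPowerExpansion_of_isLittleO hL hP (c := 0) (a := fun n => (n.factorial : ℝ))
      (by simp) (fun n => by simp [Nat.factorial_succ])
  have h1 : HasPowerExpansion atTop (fun x => (L x)⁻¹) (fun x => P (Real.exp 1 * x) * L x)
      (fun n => (numDerangements n : ℂ)) := by
    simpa using hasPowerExpansion_of_isLittleO hL hP (c := 1)
      (a := fun n => (numDerangements n : ℝ)) (by simp) fun n => by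
        have := congrArg (Int.cast : ℤ → ℝ) (numDerangements_succ n)
        push_cast at this
        rw [this]
        ring
  have h2 : HasPowerExpansion atTop (fun x => (L x)⁻¹) (fun x => P (x / Real.exp 1) * L x)
      (fun n => (numArrangements n : ℂ)) := by
    have h := hasPowerExpansion_of_isLittleO hL hP (c := -1)
      (a := fun n => (numArrangements n : ℝ)) (by simp [numArrangements]) fun n => by
        rw [numArrangements_succ]
        push_cast
        simp
    simpa [Real.exp_neg, inv_mul_eq_div] using h
  have h3 := h0.inv hz mk_factorial_mul_mk_numIndecomposablePerms
  have h4 := h1.inv hz mk_numDerangements_mul_mk_numIndecomposableDerangements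
  refine ⟨h0.hasAsymptoticExpansion_one_div hz hz0, h1.hasAsymptoticExpansion_one_div hz hz0,
    h2.hasAsymptoticExpansion_one_div hz hz0, ?_, ?_,
    hasAsymptoticContFract_factorial_jFraction hz hz0 h0,
    hasAsymptoticContFract_factorial_sFraction hz hz0 h0⟩
  -- Here `L - 1/P = -L (1/(P L) - 1)`: dropping the constant term `1` and dividing by `1/L` shifts
  -- the index to `n + 1`.
  · have h5 := ((h3.sub_div hz0).const_mul (-1)).congr' (g := fun x => L x - 1 / P x) (by
      filter_upwards [hz0] with x hx
      have : L x ≠ 0 := by simpa using hx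
      rw [if_pos rfl, div_inv_eq_mul, sub_mul, mul_inv, mul_assoc, inv_mul_cancel₀ this]
      ring)
    simpa [one_div] using h5.hasAsymptoticExpansion hz
  · refine (h4.hasAsymptoticExpansion hz).of_mul (h := L) ?_ ?_
    · filter_upwards [hz0] with x hx
      have : L x ≠ 0 := by simpa using hx
      rw [mul_inv, mul_left_comm, mul_inv_cancel₀ this, mul_one, one_div]
    · filter_upwards [hz0] with x hx m
      have : L x ≠ 0 := by simpa using hx
      rw [zpow_sub₀ this, zpow_natCast, zpow_one, one_div_div, div_eq_mul_inv, inv_pow]
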